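/- Let $\mathsf{Prop}$ be a set of propositional letters with at least three elements. Let $\mathcal L_0$ be the formulas built from letters by $\neg,\wedge$, and let $\mathcal L_1$ (the one-step formulas) be the formulas built by $\neg,\wedge$ from conditionals $\alpha\leadsto\beta$ with $\alpha,\beta\in\mathcal L_0$; the connectives $\vee,\rightarrow,\leftrightarrow$ are the usual abbreviations. Preferential conditional logic has as axioms all propositional tautologies in $\mathcal L_0$ and, for letters $p,q,r$, \[p\leadsto p,\qquad (p\leadsto q)\wedge(p\leadsto r)\rightarrow(p\leadsto q\wedge r),\] \[(p\leadsto q)\wedge(p\leadsto r)\rightarrow(p\wedge r\leadsto q),\qquad (p\leadsto q)\wedge(r\leadsto q)\rightarrow(p\vee r\leadsto q);\] its rules are modus ponens (within $\mathcal L_0$ or within $\mathcal L_1$), uniform substitution (of $\mathcal L_0$- or $\mathcal L_1$-formulas into $\mathcal L_0$-formulas, and of $\mathcal L_0$-formulas into $\mathcal L_1$-formulas), and the two rules: from $\varphi\leftrightarrow\chi$ infer $(\varphi\leadsto\psi)\leftrightarrow(\chi\leadsto\psi)$, and from $\psi\rightarrow\chi$ infer $(\varphi\leadsto\psi)\rightarrow(\varphi\leadsto\chi)$,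 for $\varphi,\psi,\chi\in\mathcal L_0$. A formula $\varphi\in\mathcal L_1$ is consistent if $\neg\varphi$ is not derivable. For a finite (possibly empty) set $W\subseteq\mathbb R^2$ let $\mathcal C=\{C'\cap W : C'\subseteq\mathbb R^2 \text{ convex}\}$ be its relative convexity, and let $V:\mathsf{Prop}\to\mathcal P(W)$ be a valuation, extended to $\mathcal L_0$ by $[\![p]\!]=V(p)$, $[\![\neg\alpha]\!]=W\setminus[\![\alpha]\!]$, $[\![\alpha\wedge\beta]\!]=[\![\alpha]\!]\cap[\![\beta]\!]$. In the model $(W,\mathcal C,V)$ a conditional $\alpha\leadsto\beta$ is true if and only if for every $C\in\mathcal C$ with $[\![\alpha]\!]\nsubseteq C$ there is $D\in\mathcal C$ with $C\subseteq D$, $[\![\alpha]\!]\nsubseteq D$ and $[\![\alpha]\!]\subseteq D\cup[\![\beta]\!]$; negation and conjunction are interpreted classically. Theorem. Every consistent formula $\varphi\in\mathcal L_1$ is true in some model $(W,\mathcal C,V)$ where $W\subseteq\mathbb R^2$ is a finite set of points and $\mathcal C$ is the relative convexity of $W$ in $\mathbb R^2$. Consequently, together with soundness, a formula of $\mathcal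 L_1$ is derivable in preferential conditional logic if and only if it is true in all such models. -/

import Mathlib

namespace PCL

universe u v

/-! ### Convex geometries -/

/-- A convex geometry on `W`: a family of subsets of `W`, the convex sets, closed under arbitrary
intersections (so `W` itself is convex) and with the anti-exchange property.
The empty set is not required to be convex. -/
structure ConvexGeometry (W : Type v) where
  IsConvex : Set W → Prop
  sInter_mem : ∀ X : Set (Set W), (∀ C ∈ X, IsConvex C) → IsConvex (⋂₀ X)
  antiExchange : ∀ C : Set W, IsConvex C → ∀ x y : W, x ∉ C → y ∉ C → x ≠ y →
    ∃ D : Set W, IsConvex D ∧ C ⊆ D ∧ ((x ∈ D ∧ y ∉ D) ∨ (x ∉ D ∧ y ∈ D))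

/-- The relative convexity on a subset `X` of a convex geometry: its convex sets are the
intersections with `X` of the convex sets of the whole space. -/
def ConvexGeometry.relative {W : Type v} (G : ConvexGeometry W) (X : Set W) :
    ConvexGeometry X where
  IsConvex C := ∃ C' : Set W, G.IsConvex C' ∧ C = {x : X | (x : W) ∈ C'}
  sInter_mem := by
    intro 𝒳 h
    refine ⟨⋂₀ {C' | G.IsConvex C' ∧ {x : X | (x : W) ∈ C'} ∈ 𝒳},
      G.sInter_mem _ fun C hC => hC.1, ?_⟩
    ext x
    constructor
    · intro hx C' hC'
      exact hx _ hC'.2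
    · intro hx C hC
      obtain ⟨C', hC', rfl⟩ := h C hC
      exact hx C' ⟨hC', hC⟩
  antiExchange := by
    rintro C ⟨C', hC', rfl⟩ x y hx hy hxy
    obtain ⟨D, hD, hCD, h⟩ :=
      G.antiExchange C' hC' x y hx hy (fun e => hxy (Subtype.ext e))
    exact ⟨{z : X | (z : W) ∈ D}, ⟨D, hD, rfl⟩, fun z hz => hCD hz, h⟩

/-- The anti-exchange property of the convex sets of a real vector space. -/
theorem convex_antiExchange {E : Type*} [AddCommGroup E] [Module ℝ E] (C : Set E)
    (hC : Convex ℝ C) (x y : E) (hx : x ∉ C) (hy : y ∉ C) (hxy : x ≠ y) :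
    ∃ D : Set E, Convex ℝ D ∧ C ⊆ D ∧ ((x ∈ D ∧ y ∉ D) ∨ (x ∉ D ∧ y ∈ D)) := by
  rcases C.eq_empty_or_nonempty with rfl | hne
  · exact ⟨{x}, convex_singleton x, Set.empty_subset _, Or.inl ⟨rfl, fun h => hxy h.symm⟩⟩
  by_contra! hcon
  have key : ∀ z : E, C ⊆ convexHull ℝ (insert z C) ∧ z ∈ convexHull ℝ (insert z C) := fun z =>
    ⟨(Set.subset_insert z C).trans (subset_convexHull ℝ _),
      subset_convexHull ℝ _ (Set.mem_insert z C)⟩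
  have h1 := (hcon _ (convex_convexHull ℝ _) (key x).1).1 (key x).2
  have h2 : x ∈ convexHull ℝ (insert y C) := by
    by_contra hn
    exact (hcon _ (convex_convexHull ℝ _) (key y).1).2 hn (key y).2
  rw [convexHull_insert hne, hC.convexHull_eq, mem_convexJoin] at h1 h2
  obtain ⟨x₀, hx₀, c, hc, a, a', ha, ha', haa, hya⟩ := h1
  obtain ⟨y₀, hy₀, d, hd, b, b', hb, hb', hbb, hxb⟩ := h2
  rw [Set.mem_singleton_iff.mp hx₀] at hya
  rw [Set.mem_singleton_iff.mp hy₀] at hxb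
  -- `y = a x + a' c` and `x = b y + b' d`
  have ha1 : a ≤ 1 := by linarith
  have hb1 : b ≤ 1 := by linarith
  by_cases hab : a * b = 1
  · have h1 : a = 1 := by nlinarith
    have h0 : a' = 0 := by linarith
    subst h1
    subst h0
    apply hxy
    simpa using hya
  · have hlt : 0 < 1 - a * b := by
      have : a * b ≤ 1 := by nlinarith
      rcases lt_or_eq_of_le this with h | h
      · linarith
      · exact absurd h hab
    apply hx
    have hsum : (1 - a * b) • x = (b * a') • c + b' • d := by
      have e : x = b • (a • x + a' • c) + b' • d := by rw [hya]; exact hxb.symm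
      calc (1 - a * b) • x = x - (a * b) • x := by rw [sub_smul, one_smul]
        _ = (b • (a • x + a' • c) + b' • d) - (a * b) • x := by rw [← e]
        _ = (b * a') • c + b' • d := by module
    have hx' : x = ((1 - a * b)⁻¹ * (b * a')) • c + ((1 - a * b)⁻¹ * b') • d := by
      rw [mul_smul _ (b * a'), mul_smul _ b', ← smul_add, ← hsum, smul_smul, inv_mul_cancel₀ hlt.ne', one_smul]
    rw [hx']
    refine hC hc hd (by positivity) (by positivity) ?_
    rw [← mul_add]
    have : b * a' + b' = 1 - a * b := by
      have : a' = 1 - a := by linarith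
      subst this
      linarith
    rw [this, inv_mul_cancel₀ hlt.ne']

/-- The Euclidean plane. -/
abbrev Plane : Type := EuclideanSpace ℝ (Fin 2)

/-- The standard convexity of the plane. -/
def standardConvexity : ConvexGeometry Plane where
  IsConvex C := Convex ℝ C
  sInter_mem _ h := convex_sInter h
  antiExchange := convex_antiExchange

/-! ### Syntax -/

/-- Formulas of classical propositional logic over the letters `P`. -/
inductive Form0 (P : Type u) : Type u where
  | atom : P → Form0 P
  | neg : Form0 P → Form0 P
  | and : Form0 P → Form0 P → Form0 P

/-- One-step formulas: Boolean combinations of conditionals between propositional formulas. -/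
inductive Form1 (P : Type u) : Type u where
  | cond : Form0 P → Form0 P → Form1 P
  | neg : Form1 P → Form1 P
  | and : Form1 P → Form1 P → Form1 P

variable {P : Type u}

def Form0.or (φ ψ : Form0 P) : Form0 P := .neg (.and (.neg φ) (.neg ψ))
def Form0.imp (φ ψ : Form0 P) : Form0 P := .neg (.and φ (.neg ψ))
def Form0.iff (φ ψ : Form0 P) : Form0 P := .and (φ.imp ψ) (ψ.imp φ)

def Form1.imp (φ ψ : Form1 P) : Form1 P := .neg (.and φ (.neg ψ))
def Form1.iff (φ ψ : Form1 P) : Form1 P := .and (φ.imp ψ) (ψ.imp φ)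

/-- Uniform substitution of propositional formulas into a propositional formula. -/
def Form0.subst (σ : P → Form0 P) : Form0 P → Form0 P
  | .atom p => σ p
  | .neg φ => .neg (φ.subst σ)
  | .and φ ψ => .and (φ.subst σ) (ψ.subst σ)

/-- Uniform substitution of one-step formulas into a propositional formula. -/
def Form0.subst1 (σ : P → Form1 P) : Form0 P → Form1 P
  | .atom p => σ p
  | .neg φ => .neg (φ.subst1 σ)
  | .and φ ψ => .and (φ.subst1 σ) (ψ.subst1 σ)

/-- Uniform substitution of propositional formulas into a one-step formula. -/
def Form1.subst (σ : P → Form0 P) : Form1 P → Form1 P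
  | .cond φ ψ => .cond (φ.subst σ) (ψ.subst σ)
  | .neg φ => .neg (φ.subst σ)
  | .and φ ψ => .and (φ.subst σ) (ψ.subst σ)

/-- The extension `⟦φ⟧_V` of a propositional formula under a valuation `V`. -/
def Form0.ext {W : Type v} (V : P → Set W) : Form0 P → Set W
  | .atom p => V p
  | .neg φ => (φ.ext V)ᶜ
  | .and φ ψ => φ.ext V ∩ ψ.ext V

/-- Truth of a propositional formula under a truth assignment. -/
def Form0.eval (a : P → Prop) : Form0 P → Prop
  | .atom p => a p
  | .neg φ => ¬ φ.eval a
  | .and φ ψ => φ.eval a ∧ ψ.eval a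

def Form0.Tautology (φ : Form0 P) : Prop := ∀ a : P → Prop, φ.eval a

/-! ### The axiomatic system -/

/-- Derivability of propositional formulas. -/
inductive Derivable0 : Form0 P → Prop where
  | taut {φ : Form0 P} : φ.Tautology → Derivable0 φ
  | mp {φ ψ : Form0 P} : Derivable0 (φ.imp ψ) → Derivable0 φ → Derivable0 ψ
  | subst {φ : Form0 P} (σ : P → Form0 P) : Derivable0 φ → Derivable0 (φ.subst σ)

open Form0 in
/-- Derivability of one-step formulas in preferential conditional logic. The four axioms are
formulated for propositional letters; their instances come from uniform substitution. -/
inductive Derivable1 : Form1 P → Prop where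
  | id (p : P) : Derivable1 (.cond (atom p) (atom p))
  | and (p q r : P) : Derivable1
      (.imp (.and (.cond (atom p) (atom q)) (.cond (atom p) (atom r)))
        (.cond (atom p) ((atom q).and (atom r))))
  | cm (p q r : P) : Derivable1
      (.imp (.and (.cond (atom p) (atom q)) (.cond (atom p) (atom r)))
        (.cond ((atom p).and (atom r)) (atom q)))
  | or (p q r : P) : Derivable1
      (.imp (.and (.cond (atom p) (atom q)) (.cond (atom r) (atom q)))
        (.cond ((atom p).or (atom r)) (atom q)))
  | mp {φ ψ : Form1 P} : Derivable1 (φ.imp ψ) → Derivable1 φ → Derivable1 ψ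
  | subst0 {φ : Form0 P} (σ : P → Form1 P) : Derivable0 φ → Derivable1 (φ.subst1 σ)
  | subst {φ : Form1 P} (σ : P → Form0 P) : Derivable1 φ → Derivable1 (φ.subst σ)
  | lle {φ χ : Form0 P} (ψ : Form0 P) : Derivable0 (φ.iff χ) →
      Derivable1 ((Form1.cond φ ψ).iff (.cond χ ψ))
  | rw {ψ χ : Form0 P} (φ : Form0 P) : Derivable0 (ψ.imp χ) →
      Derivable1 ((Form1.cond φ ψ).imp (.cond φ χ))

/-- A one-step formula is consistent if its negation is not derivable. -/
def Consistent (φ : Form1 P) : Prop := ¬ Derivable1 (.neg φ)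

/-! ### Semantics -/

/-- A model `(W, 𝒞, V)`: a set of worlds, a convex geometry on it and a valuation. -/
structure Model (P : Type u) where
  World : Type v
  geometry : ConvexGeometry World
  val : P → Set World

/-- Truth of a one-step formula in a model. -/
def Model.Satisfies (M : Model.{u, v} P) : Form1 P → Prop
  | .cond φ ψ => ∀ C, M.geometry.IsConvex C → ¬ φ.ext M.val ⊆ C →
      ∃ D, M.geometry.IsConvex D ∧ C ⊆ D ∧ ¬ φ.ext M.val ⊆ D ∧ φ.ext M.val ⊆ D ∪ ψ.ext M.val
  | .neg φ => ¬ M.Satisfies φ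
  | .and φ ψ => M.Satisfies φ ∧ M.Satisfies ψ

/-- The model on a set `W` of points of the plane with the relative convexity of `W`. -/
def planeModel (W : Set Plane) (V : P → Set W) : Model P where
  World := W
  geometry := standardConvexity.relative W
  val := V

end PCL

namespace PCL

universe u v

variable {P : Type u}

/-! ### Soundness -/

/-! Soundness is checked rule by rule. For completeness, extend a consistent formula to a theory `T`
deciding every formula. Only finitely many letters matter, so the conditionals in `T` amount to a
relation on sets of truth assignments to these letters, and the axioms say that it has the form `f A
⊆ B` for a path independent choice function `f` (`exists_pathIndependent`). In a finite convex
geometry a conditional holds iff the extreme points of the antecedent satisfy the consequent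
(`Model.satisfies_cond_iff`), so `f` has to be realised by extreme points.

By the Aizerman–Malishevski decomposition (`PathIndependent.exists_rankings`), `f A` consists of the
top elements of `A` under finitely many rankings. In the plane (`PathIndependent.exists_plane`) each
ranking gets a line through the origin, and each `x` with `x ∈ f {x}` gets two opposite points on
it, at distance `M` plus its rank. Lower points lie between the two copies of a higher one, hence
are not extreme; for `M` large, the top point is cut off by the line perpendicular to its direction.
A truth assignment may thus label several points. -/

theorem Form0.eval_subst (σ : P → Form0 P) (a : P → Prop) (φ : Form0 P) :
    (φ.subst σ).eval a ↔ φ.eval fun p => (σ p).eval a := by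
  induction φ with
  | atom p => rfl
  | neg φ ih => simp only [subst, eval, ih]
  | and φ ψ ih₁ ih₂ => simp only [subst, eval, ih₁, ih₂]

theorem Form0.ext_subst {W : Type v} (σ : P → Form0 P) (V : P → Set W) (φ : Form0 P) :
    (φ.subst σ).ext V = φ.ext fun p => (σ p).ext V := by
  induction φ with
  | atom p => rfl
  | neg φ ih => simp only [subst, ext, ih]
  | and φ ψ ih₁ ih₂ => simp only [subst, ext, ih₁, ih₂]

theorem Form0.mem_ext {W : Type v} (V : P → Set W) (φ : Form0 P) (w : W) :
    w ∈ φ.ext V ↔ φ.eval fun p => w ∈ V p := by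
  induction φ with
  | atom p => rfl
  | neg φ ih => simp only [ext, eval, Set.mem_compl_iff, ih]
  | and φ ψ ih₁ ih₂ => simp only [ext, eval, Set.mem_inter_iff, ih₁, ih₂]

theorem Form0.eval_imp (a : P → Prop) (φ ψ : Form0 P) :
    (φ.imp ψ).eval a ↔ (φ.eval a → ψ.eval a) := by
  simp [imp, eval]

theorem Form0.eval_or (a : P → Prop) (φ ψ : Form0 P) :
    (φ.or ψ).eval a ↔ (φ.eval a ∨ ψ.eval a) := by
  simp only [Form0.or, eval]; tauto

theorem Form0.eval_iff (a : P → Prop) (φ ψ : Form0 P) :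
    (φ.iff ψ).eval a ↔ (φ.eval a ↔ ψ.eval a) := by
  simp only [Form0.iff, eval, eval_imp]; tauto

theorem Form0.ext_or {W : Type v} (V : P → Set W) (φ ψ : Form0 P) :
    (φ.or ψ).ext V = φ.ext V ∪ ψ.ext V := by
  simp [Form0.or, ext, Set.compl_inter]

theorem Derivable0.tautology {φ : Form0 P} (h : Derivable0 φ) : φ.Tautology := by
  induction h with
  | taut h => exact h
  | mp _ _ ih₁ ih₂ => exact fun a => (Form0.eval_imp a _ _).1 (ih₁ a) (ih₂ a)
  | subst σ _ ih => exact fun a => (Form0.eval_subst σ a _).2 (ih _)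

theorem Model.satisfies_imp (M : Model.{u, v} P) (φ ψ : Form1 P) :
    M.Satisfies (φ.imp ψ) ↔ (M.Satisfies φ → M.Satisfies ψ) := by
  simp [Form1.imp, Satisfies]

theorem Model.satisfies_subst1 (M : Model.{u, v} P) (σ : P → Form1 P) (φ : Form0 P) :
    M.Satisfies (φ.subst1 σ) ↔ φ.eval fun p => M.Satisfies (σ p) := by
  induction φ with
  | atom p => rfl
  | neg φ ih => simp only [Form0.subst1, Form0.eval, Satisfies, ih]
  | and φ ψ ih₁ ih₂ => simp only [Form0.subst1, Form0.eval, Satisfies, ih₁, ih₂]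

/-- Substitution is absorbed into the valuation, so the induction for soundness must let the
valuation vary. -/
theorem Model.satisfies_subst {W : Type v} (G : ConvexGeometry W) (V : P → Set W)
    (σ : P → Form0 P) (φ : Form1 P) :
    (Model.mk W G V).Satisfies (φ.subst σ) ↔
      (Model.mk W G fun p => (σ p).ext V).Satisfies φ := by
  induction φ with
  | cond φ ψ => simp only [Form1.subst, Satisfies, Form0.ext_subst]
  | neg φ ih => simp only [Form1.subst, Satisfies, ih]
  | and φ ψ ih₁ ih₂ => simp only [Form1.subst, Satisfies, ih₁, ih₂]

/-- Preferential conditional logic is sound for all convex geometries. -/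
theorem Derivable1.satisfies {φ : Form1 P} (h : Derivable1 φ) {W : Type v}
    (G : ConvexGeometry W) (V : P → Set W) : (Model.mk W G V).Satisfies φ := by
  induction h generalizing V with
  | id p => exact fun C hC hn => ⟨C, hC, subset_rfl, hn, Set.subset_union_right⟩
  | and p q r =>
    rw [Model.satisfies_imp]
    rintro ⟨h₁, h₂⟩ C hC hn
    obtain ⟨D, hD, hCD, hnD, hD'⟩ := h₁ C hC hn
    obtain ⟨E, hE, hDE, hnE, hE'⟩ := h₂ D hD hnD
    refine ⟨E, hE, hCD.trans hDE, hnE, fun x hx => ?_⟩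
    rcases hD' hx with h | h
    · exact Or.inl (hDE h)
    · exact (hE' hx).imp_right fun h' => ⟨h, h'⟩
  | cm p q r =>
    rw [Model.satisfies_imp]
    rintro ⟨h₁, h₂⟩ C hC hn
    obtain ⟨D, hD, hCD, hnD, hD'⟩ := h₁ C hC fun h => hn (Set.inter_subset_left.trans h)
    obtain ⟨E, hE, hDE, hnE, hE'⟩ := h₂ D hD hnD
    -- If `E` contained `p ∧ r`, it would contain all of `p`, because the points of `p` outside `E`
    -- satisfy `r`.
    refine ⟨E, hE, hCD.trans hDE, fun h => hnE fun x hx => ?_, fun x hx => ?_⟩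
    · exact (hE' hx).elim (fun h' => h') fun h' => h ⟨hx, h'⟩
    · exact (hD' hx.1).imp_left fun h' => hDE h'
  | or p q r =>
    rw [Model.satisfies_imp]
    rintro ⟨h₁, h₂⟩
    simp only [Model.Satisfies, Form0.ext_or, Set.union_subset_iff] at h₁ h₂ ⊢
    intro C hC hn
    -- A disjunct already contained in the current convex set imposes nothing more; enlarge only for
    -- the others.
    by_cases hp : (Form0.atom p).ext V ⊆ C
    · obtain ⟨D, hD, hCD, hnD, hD'⟩ := h₂ C hC fun h => hn ⟨hp, h⟩
      exact ⟨D, hD, hCD, fun h => hnD h.2, (hp.trans hCD).trans Set.subset_union_left, hD'⟩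
    · obtain ⟨D, hD, hCD, hnD, hD'⟩ := h₁ C hC hp
      by_cases hr : (Form0.atom r).ext V ⊆ D
      · exact ⟨D, hD, hCD, fun h => hnD h.1, hD', hr.trans Set.subset_union_left⟩
      · obtain ⟨E, hE, hDE, hnE, hE'⟩ := h₂ D hD hr
        exact ⟨E, hE, hCD.trans hDE, fun h => hnE h.2,
          hD'.trans (Set.union_subset_union_left _ hDE), hE'⟩
  | mp _ _ ih₁ ih₂ => exact (Model.satisfies_imp _ _ _).1 (ih₁ V) (ih₂ V)
  | subst0 σ h => exact (Model.satisfies_subst1 _ σ _).2 (h.tautology _)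
  | subst σ _ ih => exact (Model.satisfies_subst G V σ _).2 (ih _)
  | @lle φ χ ψ h =>
    have e : φ.ext V = χ.ext V := by
      ext w
      rw [Form0.mem_ext, Form0.mem_ext]
      exact (Form0.eval_iff _ _ _).1 (h.tautology _)
    refine ⟨(Model.satisfies_imp _ _ _).2 ?_, (Model.satisfies_imp _ _ _).2 ?_⟩ <;>
      simp only [Model.Satisfies, e] <;> exact fun h => h
  | @rw ψ χ φ h =>
    have e : ψ.ext V ⊆ χ.ext V := by
      intro w
      rw [Form0.mem_ext, Form0.mem_ext]
      exact (Form0.eval_imp _ _ _).1 (h.tautology _)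
    refine (Model.satisfies_imp _ _ _).2 fun h C hC hn => ?_
    obtain ⟨D, hD, hCD, hnD, hD'⟩ := h C hC hn
    exact ⟨D, hD, hCD, hnD, hD'.trans (Set.union_subset_union_right _ e)⟩

/-! ### Theories -/

/-- The theorems of propositional logic in three schematic letters hold for one-step formulas. -/
theorem Derivable1.of_schema {p q r : P} (hpq : p ≠ q) (hpr : p ≠ r) (hqr : q ≠ r)
    {F : Form0 P} (hF : F.Tautology) (φ ψ χ : Form1 P) :
    ∃ σ : P → Form1 P, σ p = φ ∧ σ q = ψ ∧ σ r = χ ∧ Derivable1 (F.subst1 σ) := by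
  classical
  refine ⟨fun x => if x = p then φ else if x = q then ψ else χ, ?_, ?_, ?_, ?_⟩
  · simp
  · simp [hpq.symm]
  · simp [hpr.symm, hqr.symm]
  · exact .subst0 _ (.taut hF)

/-- A set of one-step formulas that contains all theorems and is closed under modus ponens. -/
structure IsTheory (T : Set (Form1 P)) : Prop where
  derivable : ∀ {φ}, Derivable1 φ → φ ∈ T
  mp : ∀ {φ ψ : Form1 P}, φ.imp ψ ∈ T → φ ∈ T → ψ ∈ T

/-! ### Propositional schemas for one-step formulas -/

theorem derivable_imp_left (hP : ∃ p q r : P, p ≠ q ∧ p ≠ r ∧ q ≠ r) (φ ψ : Form1 P) :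
    Derivable1 (φ.imp (ψ.imp φ)) := by
  obtain ⟨p, q, r, hpq, hpr, hqr⟩ := hP
  obtain ⟨σ, rfl, rfl, -, h⟩ := Derivable1.of_schema hpq hpr hqr
    (F := (Form0.atom p).imp ((Form0.atom q).imp (Form0.atom p)))
    (by intro a; simp only [Form0.eval_imp, Form0.eval]; tauto) φ ψ φ
  exact h

theorem derivable_imp_self (hP : ∃ p q r : P, p ≠ q ∧ p ≠ r ∧ q ≠ r) (φ : Form1 P) :
    Derivable1 (φ.imp φ) := by
  obtain ⟨p, q, r, hpq, hpr, hqr⟩ := hP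
  obtain ⟨σ, rfl, -, -, h⟩ := Derivable1.of_schema hpq hpr hqr
    (F := (Form0.atom p).imp (Form0.atom p))
    (by intro a; simp only [Form0.eval_imp, Form0.eval]; tauto) φ φ φ
  exact h

theorem derivable_imp_distrib (hP : ∃ p q r : P, p ≠ q ∧ p ≠ r ∧ q ≠ r) (φ ψ χ : Form1 P) :
    Derivable1 ((φ.imp (ψ.imp χ)).imp ((φ.imp ψ).imp (φ.imp χ))) := by
  obtain ⟨p, q, r, hpq, hpr, hqr⟩ := hP
  obtain ⟨σ, rfl, rfl, rfl, h⟩ := Derivable1.of_schema hpq hpr hqr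
    (F := ((Form0.atom p).imp ((Form0.atom q).imp (Form0.atom r))).imp
      (((Form0.atom p).imp (Form0.atom q)).imp ((Form0.atom p).imp (Form0.atom r))))
    (by intro a; simp only [Form0.eval_imp, Form0.eval]; tauto) φ ψ χ
  exact h

theorem derivable_cases (hP : ∃ p q r : P, p ≠ q ∧ p ≠ r ∧ q ≠ r) (φ ψ : Form1 P) :
    Derivable1 ((φ.imp ψ).imp ((φ.neg.imp ψ).imp ψ)) := by
  obtain ⟨p, q, r, hpq, hpr, hqr⟩ := hP
  obtain ⟨σ, rfl, rfl, -, h⟩ := Derivable1.of_schema hpq hpr hqr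
    (F := ((Form0.atom p).imp (Form0.atom q)).imp
      (((Form0.atom p).neg.imp (Form0.atom q)).imp (Form0.atom q)))
    (by intro a; simp only [Form0.eval_imp, Form0.eval]; tauto) φ ψ φ
  exact h

theorem derivable_imp_neg_self (hP : ∃ p q r : P, p ≠ q ∧ p ≠ r ∧ q ≠ r) (φ : Form1 P) :
    Derivable1 ((φ.imp φ.neg).imp φ.neg) := by
  obtain ⟨p, q, r, hpq, hpr, hqr⟩ := hP
  obtain ⟨σ, rfl, -, -, h⟩ := Derivable1.of_schema hpq hpr hqr
    (F := ((Form0.atom p).imp (Form0.atom p).neg).imp (Form0.atom p).neg)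
    (by intro a; simp only [Form0.eval_imp, Form0.eval]; tauto) φ φ φ
  exact h

theorem derivable_exfalso (hP : ∃ p q r : P, p ≠ q ∧ p ≠ r ∧ q ≠ r) (φ ψ : Form1 P) :
    Derivable1 (φ.imp (φ.neg.imp ψ)) := by
  obtain ⟨p, q, r, hpq, hpr, hqr⟩ := hP
  obtain ⟨σ, rfl, rfl, -, h⟩ := Derivable1.of_schema hpq hpr hqr
    (F := (Form0.atom p).imp ((Form0.atom p).neg.imp (Form0.atom q)))
    (by intro a; simp only [Form0.eval_imp, Form0.eval]; tauto) φ ψ φ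
  exact h

theorem derivable_of_neg_neg (hP : ∃ p q r : P, p ≠ q ∧ p ≠ r ∧ q ≠ r) (φ : Form1 P) :
    Derivable1 (φ.neg.neg.imp φ) := by
  obtain ⟨p, q, r, hpq, hpr, hqr⟩ := hP
  obtain ⟨σ, rfl, -, -, h⟩ := Derivable1.of_schema hpq hpr hqr
    (F := (Form0.atom p).neg.neg.imp (Form0.atom p))
    (by intro a; simp only [Form0.eval_imp, Form0.eval]; tauto) φ φ φ
  exact h

theorem derivable_and_left (hP : ∃ p q r : P, p ≠ q ∧ p ≠ r ∧ q ≠ r) (φ ψ : Form1 P) :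
    Derivable1 ((φ.and ψ).imp φ) := by
  obtain ⟨p, q, r, hpq, hpr, hqr⟩ := hP
  obtain ⟨σ, rfl, rfl, -, h⟩ := Derivable1.of_schema hpq hpr hqr
    (F := ((Form0.atom p).and (Form0.atom q)).imp (Form0.atom p))
    (by intro a; simp only [Form0.eval_imp, Form0.eval]; tauto) φ ψ φ
  exact h

theorem derivable_and_right (hP : ∃ p q r : P, p ≠ q ∧ p ≠ r ∧ q ≠ r) (φ ψ : Form1 P) :
    Derivable1 ((φ.and ψ).imp ψ) := by
  obtain ⟨p, q, r, hpq, hpr, hqr⟩ := hP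
  obtain ⟨σ, rfl, rfl, -, h⟩ := Derivable1.of_schema hpq hpr hqr
    (F := ((Form0.atom p).and (Form0.atom q)).imp (Form0.atom q))
    (by intro a; simp only [Form0.eval_imp, Form0.eval]; tauto) φ ψ φ
  exact h

theorem derivable_and_intro (hP : ∃ p q r : P, p ≠ q ∧ p ≠ r ∧ q ≠ r) (φ ψ : Form1 P) :
    Derivable1 (φ.imp (ψ.imp (φ.and ψ))) := by
  obtain ⟨p, q, r, hpq, hpr, hqr⟩ := hP
  obtain ⟨σ, rfl, rfl, -, h⟩ := Derivable1.of_schema hpq hpr hqr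
    (F := (Form0.atom p).imp ((Form0.atom q).imp ((Form0.atom p).and (Form0.atom q))))
    (by intro a; simp only [Form0.eval_imp, Form0.eval]; tauto) φ ψ φ
  exact h

/-- A consistent formula `φ` belongs to a theory that decides every formula. -/
theorem exists_complete_theory (hP : ∃ p q r : P, p ≠ q ∧ p ≠ r ∧ q ≠ r) {φ : Form1 P}
    (hφ : Consistent φ) :
    ∃ T : Set (Form1 P), IsTheory T ∧ φ ∈ T ∧ ∀ ψ : Form1 P, ψ.neg ∈ T ↔ ψ ∉ T := by
  obtain ⟨T, -, ⟨hT, hφT⟩, hmax⟩ := zorn_subset_nonempty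
    {T : Set (Form1 P) | IsTheory T ∧ φ.neg ∉ T} (by
      intro c hc hchain ⟨T₀, hT₀⟩
      refine ⟨⋃₀ c, ⟨⟨fun h => ⟨T₀, hT₀, (hc hT₀).1.derivable h⟩, ?_⟩, ?_⟩,
        fun s hs => Set.subset_sUnion_of_mem hs⟩
      · rintro ψ χ ⟨T₁, h₁, h₁'⟩ ⟨T₂, h₂, h₂'⟩
        rcases hchain.total h₁ h₂ with h | h
        · exact ⟨T₂, h₂, (hc h₂).1.mp (h h₁') h₂'⟩
        · exact ⟨T₁, h₁, (hc h₁).1.mp h₁' (h h₂')⟩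
      · rintro ⟨T₁, h₁, h₁'⟩
        exact (hc h₁).2 h₁')
    {ψ | Derivable1 ψ} ⟨⟨fun h => h, fun h h' => .mp h h'⟩, hφ⟩
  have key : ∀ ψ, ψ ∉ T → ψ.imp φ.neg ∈ T := by
    intro ψ hψ
    by_contra hn
    -- The consequences of adding `ψ` to `T` form a theory containing `T` and `ψ`; if it omitted
    -- `φ.neg`, maximality would put `ψ` in `T`.
    have hT' : IsTheory {χ | ψ.imp χ ∈ T} :=
      ⟨fun h => hT.mp (hT.derivable (derivable_imp_left hP _ _)) (hT.derivable h),
        fun h h' => hT.mp (hT.mp (hT.derivable (derivable_imp_distrib hP _ _ _)) h) h'⟩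
    exact hψ (hmax ⟨hT', hn⟩
      (fun χ hχ => hT.mp (hT.derivable (derivable_imp_left hP _ _)) hχ)
      (hT.derivable (derivable_imp_self hP ψ)))
  refine ⟨T, hT, ?_, fun ψ => ⟨fun h h' => ?_, fun h => ?_⟩⟩
  · by_contra h
    exact hφT (hT.mp (hT.derivable (derivable_imp_neg_self hP φ)) (key φ h))
  · exact hφT (hT.mp (hT.mp (hT.derivable (derivable_exfalso hP ψ _)) h') h)
  · by_contra h'
    exact hφT (hT.mp (hT.mp (hT.derivable (derivable_cases hP ψ _)) (key ψ h)) (key _ h'))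

/-! ### Rules for conditionals inside a theory -/

section Conditionals

variable {T : Set (Form1 P)}

theorem IsTheory.cond_id [Nonempty P] (hT : IsTheory T) (α : Form0 P) : Form1.cond α α ∈ T :=
  hT.derivable (.subst (fun _ => α) (.id (Classical.arbitrary P)))

/-- Simultaneous substitution for three distinct letters. -/
theorem exists_subst (hP : ∃ p q r : P, p ≠ q ∧ p ≠ r ∧ q ≠ r) (α β γ : Form0 P) :
    ∃ (p q r : P) (σ : P → Form0 P), σ p = α ∧ σ q = β ∧ σ r = γ := by
  classical
  obtain ⟨p, q, r, hpq, hpr, hqr⟩ := hP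
  refine ⟨p, q, r, fun x => if x = p then α else if x = q then β else γ, ?_, ?_, ?_⟩
  · simp
  · simp [hpq.symm]
  · simp [hpr.symm, hqr.symm]

theorem IsTheory.and_mem (hT : IsTheory T) (hP : ∃ p q r : P, p ≠ q ∧ p ≠ r ∧ q ≠ r)
    {φ ψ : Form1 P} : φ.and ψ ∈ T ↔ φ ∈ T ∧ ψ ∈ T :=
  ⟨fun h => ⟨hT.mp (hT.derivable (derivable_and_left hP _ _)) h,
    hT.mp (hT.derivable (derivable_and_right hP _ _)) h⟩,
    fun h => hT.mp (hT.mp (hT.derivable (derivable_and_intro hP _ _)) h.1) h.2⟩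

theorem IsTheory.cond_and (hT : IsTheory T) (hP : ∃ p q r : P, p ≠ q ∧ p ≠ r ∧ q ≠ r)
    {α β γ : Form0 P} (h₁ : .cond α β ∈ T) (h₂ : .cond α γ ∈ T) : .cond α (β.and γ) ∈ T := by
  obtain ⟨p, q, r, σ, rfl, rfl, rfl⟩ := exists_subst hP α β γ
  exact hT.mp (hT.derivable (.subst σ (.and p q r))) ((hT.and_mem hP).2 ⟨h₁, h₂⟩)

theorem IsTheory.cond_cm (hT : IsTheory T) (hP : ∃ p q r : P, p ≠ q ∧ p ≠ r ∧ q ≠ r)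
    {α β γ : Form0 P} (h₁ : .cond α β ∈ T) (h₂ : .cond α γ ∈ T) : .cond (α.and γ) β ∈ T := by
  obtain ⟨p, q, r, σ, rfl, rfl, rfl⟩ := exists_subst hP α β γ
  exact hT.mp (hT.derivable (.subst σ (.cm p q r))) ((hT.and_mem hP).2 ⟨h₁, h₂⟩)

theorem IsTheory.cond_or (hT : IsTheory T) (hP : ∃ p q r : P, p ≠ q ∧ p ≠ r ∧ q ≠ r)
    {α β γ : Form0 P} (h₁ : .cond α β ∈ T) (h₂ : .cond γ β ∈ T) : .cond (α.or γ) β ∈ T := by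
  obtain ⟨p, q, r, σ, rfl, rfl, rfl⟩ := exists_subst hP α β γ
  exact hT.mp (hT.derivable (.subst σ (.or p q r))) ((hT.and_mem hP).2 ⟨h₁, h₂⟩)

/-- All tautologies are axioms, so membership of a conditional depends only on the truth functions
of its two sides. This permits the passage from formulas to sets of assignments. -/
theorem IsTheory.cond_mono (hT : IsTheory T) (hP : ∃ p q r : P, p ≠ q ∧ p ≠ r ∧ q ≠ r)
    {α α' β β' : Form0 P} (hα : ∀ a, α.eval a ↔ α'.eval a) (hβ : ∀ a, β.eval a → β'.eval a)
    (h : .cond α β ∈ T) : .cond α' β' ∈ T := by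
  have h₁ : .cond α β' ∈ T :=
    hT.mp (hT.derivable (.rw α (.taut fun a => (Form0.eval_imp a _ _).2 (hβ a)))) h
  have h₂ := hT.derivable (.lle β' (.taut fun a => (Form0.eval_iff a _ _).2 (hα a)))
  exact hT.mp ((hT.and_mem hP).1 h₂).1 h₁

end Conditionals

/-! ### Path independent choice functions -/

/-- The operators of extreme points of convex geometries, with loops allowed. -/
structure PathIndependent {X : Type*} (f : Set X → Set X) : Prop where
  subset : ∀ A, f A ⊆ A
  heritage : ∀ {A B x}, A ⊆ B → x ∈ f B → x ∈ A → x ∈ f A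
  outcast : ∀ {A B}, f B ⊆ A → A ⊆ B → f A ⊆ f B

/-- An injective ranking of `Y` whose maximal elements on any subset are chosen by `f`. -/
structure IsRanking {X : Type*} (f : Set X → Set X) (Y : Set X) (r : X → ℕ) : Prop where
  injOn : Set.InjOn r Y
  mem : ∀ A ⊆ Y, ∀ x ∈ A, (∀ y ∈ A, r y ≤ r x) → x ∈ f A

/-! ### Decomposition of choice functions into rankings -/

section Rankings

variable {X : Type*} {f : Set X → Set X}

/-- A chosen `x` may be put on top: by heritage it is chosen from every subset of `Y` containing it,
and the other subsets lie in `Y \ {x}`. -/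
theorem IsRanking.exists_extend [Finite X] (hf : PathIndependent f) {Y : Set X} {x : X} {r : X → ℕ}
    (hr : IsRanking f (Y \ {x}) r) (hx : x ∈ f Y) :
    ∃ r', IsRanking f Y r' ∧ (∀ y ≠ x, r' y = r y) ∧ ∀ y, r' y ≤ r' x := by
  classical
  obtain ⟨N, hN⟩ := (Set.finite_range r).bddAbove
  have hN' : ∀ y, r y ≤ N := fun y => hN ⟨y, rfl⟩
  have hne : ∀ y ≠ x, Function.update r x (N + 1) y = r y :=
    fun y hy => Function.update_of_ne hy _ _
  have heq : Function.update r x (N + 1) x = N + 1 := Function.update_self _ _ _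
  refine ⟨Function.update r x (N + 1), ⟨?_, ?_⟩, hne, ?_⟩
  · intro y hy z hz h
    by_cases hyx : y = x <;> by_cases hzx : z = x
    · rw [hyx, hzx]
    · rw [hyx, heq, hne z hzx] at h
      have := hN' z
      omega
    · rw [hzx, heq, hne y hyx] at h
      have := hN' y
      omega
    · rw [hne y hyx, hne z hzx] at h
      exact hr.injOn ⟨hy, hyx⟩ ⟨hz, hzx⟩ h
  · intro A hA z hz hmax
    by_cases hzx : z = x
    · subst hzx
      exact hf.heritage hA hx hz
    · have hxA : x ∉ A := by
        intro hxA
        have h := hmax x hxA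
        rw [heq, hne z hzx] at h
        have := hN' z
        omega
      have hAx : ∀ y ∈ A, y ≠ x := fun y hy e => hxA (e ▸ hy)
      refine hr.mem A (fun y hy => ⟨hA hy, hAx y hy⟩) z hz fun y hy => ?_
      have h := hmax y hy
      rwa [hne y (hAx y hy), hne z hzx] at h
  · intro y
    rw [heq]
    by_cases hyx : y = x
    · rw [hyx, heq]
    · rw [hne y hyx]
      have := hN' y
      omega

/-- If `f Y` were empty, outcast for `{y} ⊆ Y` would make `f {y}` empty. -/
theorem PathIndependent.nonempty (hf : PathIndependent f) {Y : Set X} {y : X} (hy : y ∈ Y)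
    (hy' : y ∈ f {y}) : (f Y).Nonempty := by
  by_contra h
  rw [Set.not_nonempty_iff_eq_empty] at h
  have := hf.outcast (A := {y}) (B := Y) (by simp [h]) (by simpa using hy) hy'
  simp [h] at this

theorem PathIndependent.exists_ranking [Finite X] (hf : PathIndependent f) (Y : Set X)
    (hY : ∀ y ∈ Y, y ∈ f {y}) : ∃ r, IsRanking f Y r := by
  induction Y using WellFoundedLT.induction with
  | _ Y ih =>
    rcases Y.eq_empty_or_nonempty with rfl | ⟨y, hy⟩
    · exact ⟨fun _ => 0, by simp, fun A hA x hx => absurd (hA hx) (by simp)⟩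
    · obtain ⟨x, hx⟩ := hf.nonempty hy (hY y hy)
      obtain ⟨r, hr⟩ := ih (Y \ {x})
        (Set.sdiff_singleton_ssubset.2 (hf.subset Y hx)) fun y hy => hY y hy.1
      obtain ⟨r', hr', -⟩ := hr.exists_extend hf hx
      exact ⟨r', hr'⟩

/-- Remove chosen elements outside `A` from the top, one at a time. Once `f Y ⊆ A`, outcast gives `f
A ⊆ f Y`, so `b` may come next, above all the rest of `A`. -/
theorem PathIndependent.exists_ranking_max [Finite X] (hf : PathIndependent f) {A : Set X} {b : X}
    (hb : b ∈ f A) (Y : Set X) (hAY : A ⊆ Y) (hY : ∀ y ∈ Y, y ∈ f {y}) :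
    ∃ r, IsRanking f Y r ∧ ∀ y ∈ A, r y ≤ r b := by
  induction Y using WellFoundedLT.induction with
  | _ Y ih =>
    by_cases h : f Y ⊆ A
    · have hbY : b ∈ f Y := hf.outcast h hAY hb
      obtain ⟨r, hr⟩ := hf.exists_ranking (Y \ {b}) fun y hy => hY y hy.1
      obtain ⟨r', hr', -, hmax⟩ := hr.exists_extend hf hbY
      exact ⟨r', hr', fun y _ => hmax y⟩
    · obtain ⟨x, hx, hxA⟩ := Set.not_subset.1 h
      have hAx : ∀ y ∈ A, y ≠ x := fun y hy e => hxA (e ▸ hy)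
      obtain ⟨r, hr, hmax⟩ := ih (Y \ {x})
        (Set.sdiff_singleton_ssubset.2 (hf.subset Y hx))
        (fun y hy => ⟨hAY hy, hAx y hy⟩) fun y hy => hY y hy.1
      obtain ⟨r', hr', heq, -⟩ := hr.exists_extend hf hx
      refine ⟨r', hr', fun y hy => ?_⟩
      rw [heq y (hAx y hy), heq b (hAx b (hf.subset A hb))]
      exact hmax y hy

/-- Only the elements chosen from their singleton matter. -/
theorem PathIndependent.apply_inter (hf : PathIndependent f) (A : Set X) :
    f (A ∩ {x | x ∈ f {x}}) = f A := by
  have h : f A ⊆ A ∩ {x | x ∈ f {x}} := fun x hx =>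
    ⟨hf.subset A hx, hf.heritage (by simpa using hf.subset A hx) hx rfl⟩
  refine (hf.outcast h Set.inter_subset_left).antisymm fun x hx => ?_
  exact hf.heritage Set.inter_subset_left hx (h hx)

/-- A finite path independent choice function is given by the maxima of finitely many rankings. -/
theorem PathIndependent.exists_rankings [Finite X] (hf : PathIndependent f) :
    ∃ (n : ℕ) (r : Fin n → X → ℕ), (∀ i, Set.InjOn (r i) {x | x ∈ f {x}}) ∧
      ∀ A x, x ∈ f A ↔ x ∈ A ∧ x ∈ f {x} ∧ ∃ i, ∀ y ∈ A, y ∈ f {y} → r i y ≤ r i x := by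
  -- One ranking for each choice `b ∈ f A` with `A` free of loops, having `b` on top of `A`.
  let I := {q : Set X × X // q.2 ∈ f q.1 ∧ q.1 ⊆ {x | x ∈ f {x}}}
  have hI : ∀ i : I, ∃ r, IsRanking f {x | x ∈ f {x}} r ∧ ∀ y ∈ i.1.1, r y ≤ r i.1.2 :=
    fun i => hf.exists_ranking_max i.2.1 _ i.2.2 fun y hy => hy
  choose r hr hmax using hI
  obtain ⟨n, ⟨e⟩⟩ := Finite.exists_equiv_fin I
  refine ⟨n, fun i => r (e.symm i), fun i => (hr _).injOn, fun A x => ⟨fun hx => ?_, ?_⟩⟩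
  · have hx' := hx
    rw [← hf.apply_inter] at hx'
    refine ⟨hf.subset A hx, (hf.subset _ hx').2,
      e ⟨(A ∩ {x | x ∈ f {x}}, x), hx', Set.inter_subset_right⟩, fun y hy hy' => ?_⟩
    simp only [e.symm_apply_apply]
    exact hmax ⟨(A ∩ {x | x ∈ f {x}}, x), hx', Set.inter_subset_right⟩ y ⟨hy, hy'⟩
  · rintro ⟨hxA, hx, i, hi⟩
    rw [← hf.apply_inter]
    exact (hr _).mem _ Set.inter_subset_right x ⟨hxA, hx⟩ fun y hy => hi y hy.1 hy.2

end Rankings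

/-! ### Points in the plane -/

/-- `x` is an extreme point of `S`. -/
def ConvexGeometry.IsExtreme {W : Type v} (G : ConvexGeometry W) (S : Set W) (x : W) : Prop :=
  x ∈ S ∧ ∃ D, G.IsConvex D ∧ S \ {x} ⊆ D ∧ x ∉ D

/-- In a finite model a conditional is true if all extreme points of the antecedent satisfy the
consequent. -/
theorem Model.satisfies_cond_iff {P : Type u} (M : Model.{u, v} P) [Finite M.World]
    (α β : Form0 P) :
    M.Satisfies (.cond α β) ↔
      ∀ x, M.geometry.IsExtreme (α.ext M.val) x → x ∈ β.ext M.val := by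
  constructor
  · rintro h x ⟨hx, D, hD, hSD, hxD⟩
    obtain ⟨E, -, hDE, hnE, hE⟩ := h D hD fun h => hxD (h hx)
    refine (hE hx).resolve_left fun hxE => hnE fun y hy => ?_
    by_cases hyx : y = x
    · rwa [hyx]
    · exact hDE (hSD ⟨hy, hyx⟩)
  · intro h C hC hn
    -- By anti-exchange, a maximal such `D` misses exactly one point of the antecedent, which is
    -- therefore extreme.
    obtain ⟨D, hCD, ⟨hD, hnD⟩, hmax⟩ := (Set.toFinite
      {D | M.geometry.IsConvex D ∧ ¬ α.ext M.val ⊆ D}).exists_le_maximal ⟨hC, hn⟩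
    obtain ⟨x, hx, hxD⟩ := Set.not_subset.1 hnD
    have huniq : ∀ y ∈ α.ext M.val, y ∉ D → y = x := by
      intro y hy hyD
      by_contra hyx
      obtain ⟨E, hE, hDE, hE'⟩ := M.geometry.antiExchange D hD x y hxD hyD (Ne.symm hyx)
      rcases hE' with ⟨h₁, h₂⟩ | ⟨h₁, h₂⟩
      · exact hxD (hmax ⟨hE, fun h => h₂ (h hy)⟩ hDE h₁)
      · exact hyD (hmax ⟨hE, fun h => h₁ (h hx)⟩ hDE h₂)
    have hxβ : x ∈ β.ext M.val := by
      refine h x ⟨hx, D, hD, fun y hy => ?_, hxD⟩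
      by_contra hyD
      exact hy.2 (huniq y hy.1 hyD)
    refine ⟨D, hD, hCD, hnD, fun y hy => ?_⟩
    by_cases hyD : y ∈ D
    · exact Or.inl hyD
    · exact Or.inr (huniq y hy hyD ▸ hxβ)

open scoped RealInnerProductSpace

/-- Finitely many unit vectors, no two of which are equal or opposite. -/
theorem exists_unit_vectors (n : ℕ) :
    ∃ u : Fin n × ℤˣ → Plane, Function.Injective u ∧ (∀ i, ‖u i‖ = 1) ∧
      ∀ i s, u (i, -s) = -u (i, s) := by
  -- Distinct angles in `(0, 1]` have distinct positive cosines, so first coordinates separate all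
  -- the vectors and their negatives.
  let θ : Fin n → ℝ := fun i => 1 / ((i : ℝ) + 1)
  have hθ : ∀ i, 0 < θ i ∧ θ i ≤ 1 := by
    intro i
    have : (0 : ℝ) ≤ (i : ℝ) := Nat.cast_nonneg _
    refine ⟨by positivity, ?_⟩
    rw [div_le_one (by positivity)]
    linarith
  have hθinj : Function.Injective θ := by
    intro i j h
    have h' : ((i : ℝ) + 1) = (j : ℝ) + 1 := by
      have := congrArg (fun x => 1 / x) h
      simpa [θ] using this
    exact Fin.ext (by exact_mod_cast add_right_cancel h')
  have hcos : ∀ i, 0 < Real.cos (θ i) := fun i =>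
    Real.cos_pos_of_mem_Ioo ⟨by linarith [(hθ i).1, Real.pi_pos],
      by linarith [(hθ i).2, Real.pi_gt_three]⟩
  have hcosinj : ∀ i j, Real.cos (θ i) = Real.cos (θ j) → i = j := fun i j h =>
    hθinj (Real.injOn_cos ⟨(hθ i).1.le, by linarith [(hθ i).2, Real.pi_gt_three]⟩
      ⟨(hθ j).1.le, by linarith [(hθ j).2, Real.pi_gt_three]⟩ h)
  let v : Fin n → Plane := fun i => !₂[Real.cos (θ i), Real.sin (θ i)]
  have hv : ∀ i, v i 0 = Real.cos (θ i) := fun i => rfl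
  refine ⟨fun q => (((q.2 : ℤˣ) : ℤ) : ℝ) • v q.1, ?_, ?_, ?_⟩
  · rintro ⟨i, s⟩ ⟨j, t⟩ h
    have h0 := congrArg (fun w : Plane => w 0) h
    have hi := hcos i
    have hj := hcos j
    rcases Int.units_eq_one_or s with rfl | rfl <;> rcases Int.units_eq_one_or t with rfl | rfl <;>
      simp [hv] at h0
    · rw [hcosinj i j h0]
    · linarith
    · linarith
    · rw [hcosinj i j h0]
  · rintro ⟨i, s⟩
    have : ‖v i‖ = 1 := by
      simp [v, EuclideanSpace.norm_eq, Fin.sum_univ_two]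
    rcases Int.units_eq_one_or s with rfl | rfl <;> simp [norm_neg, this]
  · intro i s
    simp

/-- A finite path independent choice function is realised by the extreme points of finitely many
labelled points of the plane. -/
theorem PathIndependent.exists_plane {X : Type*} [Finite X] {f : Set X → Set X}
    (hf : PathIndependent f) :
    ∃ W : Set Plane, W.Finite ∧ ∃ l : W → X, ∀ A x,
      x ∈ f A ↔ ∃ w, l w = x ∧ (standardConvexity.relative W).IsExtreme (l ⁻¹' A) w := by
  obtain ⟨n, r, hinj, hr⟩ := hf.exists_rankings
  obtain ⟨u, huinj, hu1, huneg⟩ := exists_unit_vectors n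
  have hlt : ∀ d e, d ≠ e → ⟪u d, u e⟫ < 1 := fun d e hde =>
    (inner_lt_one_iff_real_of_norm_eq_one (hu1 d) (hu1 e)).2 fun h => hde (huinj h)
  -- Distinct unit vectors have inner product below 1, so for large `M` every point off the ray of
  -- `u d` projects onto it at less than `M`.
  obtain ⟨M, hM0, hM⟩ : ∃ M : ℝ, 0 < M ∧ ∀ (d e : Fin n × ℤˣ) (x : X), d ≠ e →
      (M + r e.1 x) * ⟪u d, u e⟫ < M := by
    have : ∀ᶠ M : ℝ in Filter.atTop, 0 < M ∧ ∀ (d e : Fin n × ℤˣ) (x : X), d ≠ e →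
        (M + r e.1 x) * ⟪u d, u e⟫ < M := by
      refine (Filter.eventually_gt_atTop 0).and ?_
      simp only [Filter.eventually_all]
      intro d e x hde
      have h := hlt d e hde
      filter_upwards [Filter.eventually_gt_atTop
        ((r e.1 x) * ⟪u d, u e⟫ / (1 - ⟪u d, u e⟫))] with M hM
      rw [div_lt_iff₀ (by linarith)] at hM
      linarith
    exact this.exists
  let J := (Fin n × ℤˣ) × {x : X // x ∈ f {x}}
  let pt : J → Plane := fun q => (M + r q.1.1 q.2) • u q.1
  have hpos : ∀ (i : Fin n) (x : X), 0 < M + (r i x : ℝ) := fun i x => by positivity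
  have hptinj : Function.Injective pt := by
    rintro ⟨d, x⟩ ⟨e, y⟩ h
    have hnorm := congrArg norm h
    simp only [pt, norm_smul, hu1, mul_one, Real.norm_eq_abs, abs_of_pos (hpos _ _)] at hnorm
    have hde : d = e := by
      apply huinj
      have h' : (M + r d.1 x) • u d = (M + r e.1 y) • u e := h
      rw [hnorm] at h'
      exact smul_right_injective _ (hpos e.1 y).ne' h'
    subst hde
    have : r d.1 x = r d.1 y := by exact_mod_cast add_left_cancel hnorm
    rw [Subtype.ext (hinj d.1 x.2 y.2 this)]
  let idx := Equiv.ofInjective pt hptinj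
  have hidx : ∀ q, ((idx q : Set.range pt) : Plane) = pt q := fun q => rfl
  refine ⟨Set.range pt, Set.finite_range pt, fun w => (idx.symm w).2, fun A x => ?_⟩
  rw [hr]
  constructor
  · rintro ⟨hxA, hx, i, hi⟩
    refine ⟨idx ((i, 1), ⟨x, hx⟩), by simp, by simpa using hxA,
      {w | ⟪u (i, 1), (w : Plane)⟫ < M + r i x},
      ⟨{w | ⟪u (i, 1), w⟫ < M + r i x}, ?_, rfl⟩, ?_, ?_⟩
    · exact convex_halfSpace_lt (innerₗ Plane (u (i, 1))).isLinear _
    · intro w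
      obtain ⟨⟨d, y⟩, rfl⟩ := idx.surjective w
      rintro ⟨hyA, hne⟩
      have hyA' : (y : X) ∈ A := by simpa using hyA
      have hne : ¬ (d = (i, 1) ∧ (y : X) = x) := by
        rintro ⟨rfl, rfl⟩
        exact hne rfl
      change ⟪u (i, 1), (M + r d.1 y) • u d⟫ < M + r i x
      rw [real_inner_smul_right]
      by_cases hd : (i, 1) = d
      · subst hd
        rw [real_inner_self_eq_norm_sq, hu1]
        have hle := hi y hyA' y.2
        have hne' : r i y ≠ r i x := fun h => hne ⟨rfl, hinj i y.2 hx h⟩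
        have : (r i y : ℝ) < r i x := by exact_mod_cast lt_of_le_of_ne hle hne'
        simpa using this
      · have := hM _ _ (y : X) hd
        have : (0 : ℝ) ≤ r i x := Nat.cast_nonneg _
        linarith
    · change ¬ ⟪u (i, 1), (M + r i x) • u (i, 1)⟫ < M + r i x
      rw [real_inner_smul_right, real_inner_self_eq_norm_sq, hu1]
      simp
  · rintro ⟨w, hwx, hwA, D, ⟨D', hD', rfl⟩, hsub, hwD⟩
    obtain ⟨⟨⟨i, s⟩, ⟨x', hx'⟩⟩, rfl⟩ := idx.surjective w
    obtain rfl : x' = x := by simpa using hwx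
    have hxA : x' ∈ A := by simpa using hwA
    refine ⟨hxA, hx', i, fun y hyA hy => ?_⟩
    by_contra! hlt
    have hyx : y ≠ x' := fun e => by simp [e] at hlt
    -- Both copies of the higher ranked `y` carry a label in `A` other than `x'`, so they lie in
    -- `D'`.
    have hmem : ∀ t, (M + r i y) • u (i, t) ∈ D' := by
      intro t
      refine hsub (a := idx ((i, t), ⟨y, hy⟩)) ⟨by simpa using hyA, fun h => ?_⟩
      exact hyx (congrArg (fun q : J => (q.2 : X)) (idx.injective h))
    have h₁ := hmem s
    have h₂ := hmem (-s)
    rw [huneg] at h₂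
    apply hwD
    change (M + r i x') • u (i, s) ∈ D'
    have hx0 := hpos i x'
    have hy0 := hpos i y
    have hlt' : (r i x' : ℝ) < r i y := by exact_mod_cast hlt
    set c := (M + (r i x' : ℝ)) / (M + r i y)
    have hc0 : 0 ≤ c := by positivity
    have hc1 : c ≤ 1 := by
      rw [div_le_one hy0]
      linarith
    have hc : M + (r i x' : ℝ) = c * (M + r i y) := by
      simp only [c]
      field_simp
    -- The point of `x'` is `c` times that of `y`, and `c = (1 + c) / 2 - (1 - c) / 2`.
    have := hD' h₁ h₂ (a := (1 + c) / 2) (b := (1 - c) / 2) (by linarith) (by linarith) (by ring)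
    convert this using 1
    rw [hc]
    module

/-! ### Completeness -/

/-- The truth value of a propositional formula is determined by the letters in `S`. -/
def Form0.DependsOn (S : Finset P) (α : Form0 P) : Prop :=
  ∀ a b : P → Prop, (∀ p ∈ S, a p ↔ b p) → (α.eval a ↔ α.eval b)

/-- All antecedents and consequents of a one-step formula depend only on the letters in `S`. -/
def Form1.DependsOn (S : Finset P) : Form1 P → Prop
  | .cond α β => α.DependsOn S ∧ β.DependsOn S
  | .neg φ => φ.DependsOn S
  | .and φ ψ => φ.DependsOn S ∧ ψ.DependsOn S

theorem Form0.DependsOn.mono {S S' : Finset P} (h : S ⊆ S') {α : Form0 P} (hα : α.DependsOn S) :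
    α.DependsOn S' :=
  fun a b hab => hα a b fun p hp => hab p (h hp)

theorem Form1.DependsOn.mono {S S' : Finset P} (h : S ⊆ S') {φ : Form1 P} (hφ : φ.DependsOn S) :
    φ.DependsOn S' := by
  induction φ with
  | cond α β => exact ⟨hφ.1.mono h, hφ.2.mono h⟩
  | neg φ ih => exact ih hφ
  | and φ ψ ih₁ ih₂ => exact ⟨ih₁ hφ.1, ih₂ hφ.2⟩

theorem Form0.exists_dependsOn (α : Form0 P) : ∃ S : Finset P, α.DependsOn S := by
  classical
  induction α with
  | atom p => exact ⟨{p}, fun a b h => h p (by simp)⟩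
  | neg α ih =>
    obtain ⟨S, hS⟩ := ih
    exact ⟨S, fun a b h => not_congr (hS a b h)⟩
  | and α β ih₁ ih₂ =>
    obtain ⟨S₁, h₁⟩ := ih₁
    obtain ⟨S₂, h₂⟩ := ih₂
    exact ⟨S₁ ∪ S₂, fun a b h => and_congr (h₁.mono Finset.subset_union_left a b h)
      (h₂.mono Finset.subset_union_right a b h)⟩

theorem Form1.exists_dependsOn (φ : Form1 P) : ∃ S : Finset P, φ.DependsOn S := by
  classical
  induction φ with
  | cond α β =>
    obtain ⟨S₁, h₁⟩ := α.exists_dependsOn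
    obtain ⟨S₂, h₂⟩ := β.exists_dependsOn
    exact ⟨S₁ ∪ S₂, h₁.mono Finset.subset_union_left, h₂.mono Finset.subset_union_right⟩
  | neg φ ih => exact ih
  | and φ ψ ih₁ ih₂ =>
    obtain ⟨S₁, h₁⟩ := ih₁
    obtain ⟨S₂, h₂⟩ := ih₂
    exact ⟨S₁ ∪ S₂, h₁.mono Finset.subset_union_left, h₂.mono Finset.subset_union_right⟩

theorem exists_eval_iff_forall_mem [Nonempty P] (S : Finset P) (a : P → Prop) :
    ∃ α : Form0 P, ∀ b, α.eval b ↔ ∀ p ∈ S, b p ↔ a p := by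
  classical
  induction S using Finset.induction_on with
  | empty =>
    obtain ⟨p⟩ := ‹Nonempty P›
    exact ⟨(Form0.atom p).imp (.atom p), fun b => by simp [Form0.eval_imp]⟩
  | insert p S _ ih =>
    obtain ⟨α, hα⟩ := ih
    by_cases hp : a p
    · exact ⟨(Form0.atom p).and α, fun b => by simp [Form0.eval, hα, hp]⟩
    · exact ⟨(Form0.atom p).neg.and α, fun b => by simp [Form0.eval, hα, hp]⟩

/-- Every set of truth assignments to finitely many letters is defined by a formula. -/
theorem exists_eval_iff_mem [Nonempty P] (S : Finset P) (A : Set (S → Prop)) :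
    ∃ α : Form0 P, ∀ a, α.eval a ↔ (fun p : S => a p) ∈ A := by
  induction A, A.toFinite using Set.Finite.induction_on with
  | empty =>
    obtain ⟨p⟩ := ‹Nonempty P›
    exact ⟨(Form0.atom p).and (Form0.atom p).neg, fun b => by simp [Form0.eval]⟩
  | @insert x A _ _ ih =>
    obtain ⟨α, hα⟩ := ih
    -- `x` is extended by falsity outside `S`; those values play no role.
    obtain ⟨β, hβ⟩ := exists_eval_iff_forall_mem S fun p => ∃ h : p ∈ S, x ⟨p, h⟩
    refine ⟨β.or α, fun b => ?_⟩
    rw [Form0.eval_or, hα, hβ, Set.mem_insert_iff]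
    refine or_congr_left ⟨fun h => ?_, ?_⟩
    · ext ⟨p, hp⟩
      simpa [hp] using h p hp
    · rintro rfl p hp
      simp [hp]

/-- Preferential consequence on a finite algebra of sets is given by a path independent choice
function. -/
theorem exists_pathIndependent {X : Type*} [Finite X] {N : Set X → Set X → Prop}
    (hid : ∀ A, N A A) (hmono : ∀ {A B C}, N A B → B ⊆ C → N A C)
    (hand : ∀ {A B C}, N A B → N A C → N A (B ∩ C))
    (hcm : ∀ {A B C}, N A B → N A C → N (A ∩ C) B)
    (hor : ∀ {A B C}, N A B → N C B → N (A ∪ C) B) :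
    ∃ f : Set X → Set X, PathIndependent f ∧ ∀ A B, N A B ↔ f A ⊆ B := by
  have hmem : ∀ {A x}, x ∉ A → N A {x}ᶜ := fun hx =>
    hmono (hid _) (Set.subset_compl_singleton_iff.2 hx)
  -- Since `X` is finite, the sets `B` with `N A B` form a principal filter; its generator consists
  -- of the points that cannot be left out.
  have hiff : ∀ A B, N A B ↔ {x | ¬ N A {x}ᶜ} ⊆ B := by
    refine fun A B => ⟨fun h x hx => ?_, fun h => ?_⟩
    · by_contra hxB
      exact hx (hmono h (Set.subset_compl_singleton_iff.2 hxB))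
    · have : ∀ C : Set X, (∀ x ∈ C, N A {x}ᶜ) → N A Cᶜ := by
        intro C
        induction C, C.toFinite using Set.Finite.induction_on with
        | empty => exact fun _ => hmono (hid A) (by simp)
        | @insert x C _ _ ih =>
          intro hC
          rw [Set.insert_eq, Set.compl_union]
          exact hand (hC x (by simp)) (ih fun y hy => hC y (by simp [hy]))
      rw [← compl_compl B]
      refine this Bᶜ fun x hx => ?_
      by_contra hn
      exact hx (h hn)
  refine ⟨fun A => {x | ¬ N A {x}ᶜ}, ⟨fun A => (hiff A A).1 (hid A), ?_, ?_⟩, hiff⟩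
  -- Heritage is the rule for disjunction: if `x` can be left out for `A`, it can be left out for `B
  -- = A ∪ (B \ A)`.
  · intro A B x hAB hx hxA h
    refine hx ?_
    have := hor h (hmem (A := B \ A) (x := x) fun h => h.2 hxA)
    rwa [Set.union_sdiff_cancel hAB] at this
  -- Outcast is cautious monotonicity, applied to `N B (f B)` and `N B A`.
  · intro A B hBA hAB
    have := hcm ((hiff B _).2 subset_rfl) ((hiff B A).2 hBA)
    rw [Set.inter_eq_self_of_subset_right hAB] at this
    exact (hiff A _).1 this

/-- Every consistent one-step formula is true in a finite set of points of the plane. -/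
theorem Consistent.exists_planeModel (hP : ∃ p q r : P, p ≠ q ∧ p ≠ r ∧ q ≠ r) {φ : Form1 P}
    (hφ : Consistent φ) :
    ∃ W : Set Plane, W.Finite ∧ ∃ V : P → Set W, (planeModel W V).Satisfies φ := by
  have : Nonempty P := ⟨hP.choose⟩
  obtain ⟨T, hT, hφT, hneg⟩ := exists_complete_theory hP hφ
  obtain ⟨S, hS⟩ := φ.exists_dependsOn
  choose χ hχ using exists_eval_iff_mem S
  obtain ⟨f, hf, hfT⟩ := exists_pathIndependent (N := fun A B => .cond (χ A) (χ B) ∈ T)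
    (fun A => hT.cond_id _)
    (fun h hBC => hT.cond_mono hP (fun _ => .rfl)
      (fun a ha => (hχ _ a).2 (hBC ((hχ _ a).1 ha))) h)
    (fun h₁ h₂ => hT.cond_mono hP (fun _ => .rfl)
      (fun a ha => by simpa only [Form0.eval, hχ, Set.mem_inter_iff] using ha) (hT.cond_and hP h₁ h₂))
    (fun h₁ h₂ => hT.cond_mono hP
      (fun a => by simp only [Form0.eval, hχ, Set.mem_inter_iff]) (fun _ h => h)
      (hT.cond_cm hP h₁ h₂))
    (fun h₁ h₂ => hT.cond_mono hP
      (fun a => by simp only [Form0.eval_or, hχ, Set.mem_union]) (fun _ h => h)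
      (hT.cond_or hP h₁ h₂))
  obtain ⟨W, hW, l, hl⟩ := hf.exists_plane
  -- Assignments to `S` are made total by falsity; each point then satisfies the letters true under
  -- its label.
  let e : (S → Prop) → P → Prop := fun x p => ∃ h : p ∈ S, x ⟨p, h⟩
  let V : P → Set W := fun p => {w | e (l w) p}
  refine ⟨W, hW, V, ?_⟩
  have : Finite (planeModel W V).World := hW.to_subtype
  have hχe : ∀ α : Form0 P, α.DependsOn S →
      ∀ a, α.eval a ↔ (χ {x | α.eval (e x)}).eval a := by
    intro α hα a
    rw [hχ]
    exact hα _ _ fun p hp => by simp [e, hp]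
  have hext : ∀ α : Form0 P, α.ext V = l ⁻¹' {x | α.eval (e x)} := by
    intro α
    ext w
    exact Form0.mem_ext V α w
  -- The truth lemma is restricted to formulas over `S`, as labels record nothing about other
  -- letters.
  suffices h : ∀ ψ : Form1 P, ψ.DependsOn S → ((planeModel W V).Satisfies ψ ↔ ψ ∈ T) from
    (h φ hS).2 hφT
  intro ψ hψ
  induction ψ with
  | cond α β =>
    have hcond : .cond α β ∈ T ↔ f {x | α.eval (e x)} ⊆ {x | β.eval (e x)} := by
      rw [← hfT]
      exact ⟨hT.cond_mono hP (hχe α hψ.1) fun a => (hχe β hψ.2 a).1,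
        hT.cond_mono hP (fun a => (hχe α hψ.1 a).symm) fun a => (hχe β hψ.2 a).2⟩
    rw [hcond, Model.satisfies_cond_iff]
    change (∀ w : W, (standardConvexity.relative W).IsExtreme (α.ext V) w → w ∈ β.ext V) ↔ _
    rw [hext, hext]
    constructor
    · intro h x hx
      obtain ⟨w, rfl, hw⟩ := (hl _ _).1 hx
      exact h w hw
    · exact fun h w hw => h ((hl _ _).2 ⟨w, rfl, hw⟩)
  | neg ψ ih => exact (not_congr (ih hψ)).trans (hneg ψ).symm
  | and ψ₁ ψ₂ ih₁ ih₂ => exact (and_congr (ih₁ hψ.1) (ih₂ hψ.2)).trans (hT.and_mem hP).symm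

end PCL

theorem mainTheorem1 {P : Type*} (hP : ∃ p q r : P, p ≠ q ∧ p ≠ r ∧ q ≠ r) :
    (∀ φ : PCL.Form1 P, PCL.Consistent φ →
      ∃ W : Set PCL.Plane, W.Finite ∧ ∃ V : P → Set W, (PCL.planeModel W V).Satisfies φ) ∧
    (∀ φ : PCL.Form1 P, PCL.Derivable1 φ ↔
      ∀ W : Set PCL.Plane, W.Finite → ∀ V : P → Set W, (PCL.planeModel W V).Satisfies φ) := by
  refine ⟨fun φ hφ => hφ.exists_planeModel hP, fun φ => ⟨fun h W _ V => h.satisfies _ V, ?_⟩⟩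
  intro h
  by_contra hφ
  have hcons : PCL.Consistent φ.neg := fun h' =>
    hφ (.mp (PCL.derivable_of_neg_neg hP φ) h')
  obtain ⟨W, hW, V, hV⟩ := hcons.exists_planeModel hP
  exact hV (h W hW V)
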